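/- Consider finite untyped $\lambda$-terms modulo renaming of bound variables, with $\beta$-reduction $\to_\beta$ (the compatible closure of $(\lambda x.P)Q \to P[x:=Q]$) and $\beta$-convertibility $=_\beta$ (its equivalence closure). A head normal form (hnf) is a term $\lambda x_1\ldots x_n.\,y M_1\ldots M_m$ with $n,m\ge 0$; a term has an hnf if it $\beta$-reduces to one. A head step is a step $\lambda x_1\ldots x_n.(\lambda y.P)Q N_1\ldots N_m \to_h \lambda x_1\ldots x_n.\,P[y:=Q] N_1\ldots N_m$; a term with an hnf reaches an hnf by a unique head reduction. The clocked Böhm tree $\mathrm{BT}_c(M)$ is the possibly infinite term, annotated with natural numbers at some nodes, defined coinductively: if $M$ has no hnf, it is $\bot$ (without annotation); if $M \to_h^k \lambda x_1\ldots x_n.\,y M_1\ldots M_m$ is the head reduction to hnf, it is $\lambda x_1\ldots x_n.\,y\,\mathrm{BT}_c(M_1)\ldots\mathrm{BT}_c(M_m)$ with its root annotated by $k$. Positions are finite sequences over $\{0,1,2\}$, where $0$ leads from an abstraction to its body and $1$, $2$ lead from an application to its function and its argument. We say that $M$ improves $N$ eventually if $\mathrm{BT}_c(M)$ and $\mathrm{BT}_c(N)$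 are equal after dropping all annotations and there is $\ell\in\mathbb N$ such that at every position $p$ of $\mathrm{BT}_c(M)$ of length at least $\ell$ either neither tree is annotated, or both are, with annotations $k_1$ in $\mathrm{BT}_c(M)$ and $k_2$ in $\mathrm{BT}_c(N)$ satisfying $k_1\le k_2$. A redex $(\lambda x.P)Q$ is simple if $x$ has at most one free occurrence in $P$ (linear) or $Q$ is a $\beta$-normal form (call-by-value). The set of simple terms is the largest set $X$ such that every $M\in X$ either has no hnf, or its head reduction to hnf $\lambda x_1\ldots x_n.\,y M_1\ldots M_m$ contracts only simple redexes and $M_1,\ldots,M_m\in X$. Theorem. Let $M$ and $N$ be $\lambda$-terms such that $M$ is simple. If $M$ does not improve $N$ eventually, then $M \ne_\beta N$. -/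

import Mathlib

/-- Finite `λ`-terms modulo renaming of bound variables, in de Bruijn notation: `var i` refers to
the `i`-th enclosing binder, and indices that exceed the number of enclosing binders are the
(countably many) free variables. -/
inductive LTerm : Type
  | var (i : ℕ) : LTerm
  | lam (M : LTerm) : LTerm
  | app (M N : LTerm) : LTerm

namespace LTerm

/-- A renaming of variables, pushed under a binder. -/
def upRen (ξ : ℕ → ℕ) : ℕ → ℕ
  | 0 => 0
  | i + 1 => ξ i + 1

/-- Renaming of the free variables. -/
def rename : (ℕ → ℕ) → LTerm → LTerm
  | ξ, var i => var (ξ i)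
  | ξ, lam M => lam (rename (upRen ξ) M)
  | ξ, app M N => app (rename ξ M) (rename ξ N)

/-- A substitution, pushed under a binder. -/
def upSub (σ : ℕ → LTerm) : ℕ → LTerm
  | 0 => var 0
  | i + 1 => rename Nat.succ (σ i)

/-- Simultaneous capture-avoiding substitution for the free variables. -/
def subst : (ℕ → LTerm) → LTerm → LTerm
  | σ, var i => σ i
  | σ, lam M => lam (subst (upSub σ) M)
  | σ, app M N => app (subst σ M) (subst σ N)

/-- The substitution of `N` for variable `0`; the other variables are lowered by one. -/
def single (N : LTerm) : ℕ → LTerm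
  | 0 => N
  | i + 1 => var i

/-- `M.inst N` is `M[x := N]`, the contractum of the redex `(λx.M) N`. -/
def inst (M N : LTerm) : LTerm := subst (single N) M

/-- The number of free occurrences of the variable `i` in a term. -/
def occ : ℕ → LTerm → ℕ
  | i, var j => if i = j then 1 else 0
  | i, lam M => occ (i + 1) M
  | i, app M N => occ i M + occ i N

/-- One-step `β`-reduction: the compatible closure of the `β`-rule. -/
inductive Step : LTerm → LTerm → Prop
  | beta (M N : LTerm) : Step (app (lam M) N) (M.inst N)
  | lam {M M' : LTerm} (h : Step M M') : Step (lam M) (lam M')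
  | appL {M M' : LTerm} (N : LTerm) (h : Step M M') : Step (app M N) (app M' N)
  | appR (M : LTerm) {N N' : LTerm} (h : Step N N') : Step (app M N) (app M N')

/-- Many-step `β`-reduction. -/
def Red : LTerm → LTerm → Prop := Relation.ReflTransGen Step

/-- `β`-convertibility: the equivalence closure of one-step `β`-reduction. -/
def Conv : LTerm → LTerm → Prop := Relation.EqvGen Step

/-- `β`-normal forms. -/
def IsNormal (M : LTerm) : Prop := ∀ M', ¬ Step M M'

/-- `lams n M` is `λx₁ … λxₙ. M`. -/
def lams : ℕ → LTerm → LTerm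
  | 0, M => M
  | n + 1, M => lam (lams n M)

/-- `apps M [N₁, …, Nₘ]` is `M N₁ … Nₘ`, associated to the left. -/
def apps (M : LTerm) (Ns : List LTerm) : LTerm := Ns.foldl app M

/-- `H` is a head normal form `λx₁ … λxₙ. y N₁ … Nₘ`. -/
def IsHnf (H : LTerm) : Prop := ∃ n y Ns, H = lams n (apps (var y) Ns)

/-- `M` has a head normal form, that is, it reduces to one. -/
def HasHnf (M : LTerm) : Prop := ∃ H, Red M H ∧ IsHnf H

/-- A head reduction step
`λx₁ … λxₙ. (λy.P) Q N₁ … Nₘ → λx₁ … λxₙ. P[y := Q] N₁ … Nₘ`. -/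
inductive HeadStep : LTerm → LTerm → Prop
  | mk (n : ℕ) (P Q : LTerm) (Ns : List LTerm) :
      HeadStep (lams n (apps (app (lam P) Q) Ns)) (lams n (apps (P.inst Q) Ns))

/-- `HeadRed k M N`: there is a head reduction from `M` to `N` of exactly `k` steps. -/
inductive HeadRed : ℕ → LTerm → LTerm → Prop
  | refl (M : LTerm) : HeadRed 0 M M
  | step {k : ℕ} {M P N : LTerm} (h : HeadStep M P) (h' : HeadRed k P N) : HeadRed (k + 1) M N

/-- The redex `(λx.P) Q` is linear: `x` has at most one occurrence in `P`. -/
def LinearRedex (P _Q : LTerm) : Prop := occ 0 P ≤ 1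

/-- The redex `(λx.P) Q` is call-by-value: `Q` is a normal form. -/
def CallByValueRedex (_P Q : LTerm) : Prop := IsNormal Q

/-- The redex `(λx.P) Q` is simple: it is linear or call-by-value. -/
def SimpleRedex (P Q : LTerm) : Prop := LinearRedex P Q ∨ CallByValueRedex P Q

/-- A head reduction step that contracts a simple redex. -/
inductive SimpleHeadStep : LTerm → LTerm → Prop
  | mk (n : ℕ) (P Q : LTerm) (Ns : List LTerm) (h : SimpleRedex P Q) :
      SimpleHeadStep (lams n (apps (app (lam P) Q) Ns)) (lams n (apps (P.inst Q) Ns))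

/-- The condition on a set `X` of terms of which the set of simple terms is the largest solution:
every `M ∈ X` has no head normal form, or its head reduction to head normal form contracts only
simple redexes and the arguments of that head normal form are again in `X`. -/
def SimpleClosed (X : Set LTerm) : Prop :=
  ∀ M ∈ X, ¬ HasHnf M ∨
    ∃ n y Ns, Relation.ReflTransGen SimpleHeadStep M (lams n (apps (var y) Ns)) ∧ ∀ N ∈ Ns, N ∈ X

/-- Simple terms (a coinductive notion: membership in the largest `SimpleClosed` set). -/
def Simple (M : LTerm) : Prop := ∃ X : Set LTerm, SimpleClosed X ∧ M ∈ X

end LTerm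

/-- The symbols at the nodes of a finite or infinite `λ`-term with `⊥`. -/
inductive NodeSym : Type
  | bot : NodeSym
  | var (i : ℕ) : NodeSym
  | lam : NodeSym
  | app : NodeSym

/-- A symbol together with an optional annotation by a natural number. -/
structure NodeLabel : Type where
  sym : NodeSym
  ann : Option ℕ

/-- Positions are sequences over `{0, 1, 2}`: `0` leads to the body of an abstraction, `1` and `2`
to the function and the argument of an application. -/
abbrev TreePos : Type := List (Fin 3)

/-- Finite or infinite annotated terms, given by the label at each position; the value at `p` is
`none` if `p` is not a position of the term. -/
abbrev AnnTree : Type := TreePos → Option NodeLabel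

namespace AnnTree

/-- The set of positions of an annotated term. -/
def positions (T : AnnTree) : Set TreePos := {p | (T p).isSome}

/-- The unannotated term obtained by dropping all annotations. -/
def deannotate (T : AnnTree) : TreePos → Option NodeSym := fun p => (T p).map NodeLabel.sym

/-- `p` is a position of both `T₁` and `T₂`, and at `p` either neither is annotated, or both are
and the annotations are related by `R`. -/
def RelAt (R : ℕ → ℕ → Prop) (T₁ T₂ : AnnTree) (p : TreePos) : Prop :=
  ∃ l₁ l₂, T₁ p = some l₁ ∧ T₂ p = some l₂ ∧
    ((l₁.ann = none ∧ l₂.ann = none) ∨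
      ∃ k₁ k₂, l₁.ann = some k₁ ∧ l₂.ann = some k₂ ∧ R k₁ k₂)

/-- `R` holds eventually between `T₁` and `T₂`: without annotations they are the same term, and
`R` holds at all positions from some depth on. -/
def RelEventually (R : ℕ → ℕ → Prop) (T₁ T₂ : AnnTree) : Prop :=
  T₁.deannotate = T₂.deannotate ∧
    ∃ l : ℕ, ∀ p ∈ T₁.positions, l ≤ p.length → RelAt R T₁ T₂ p

end AnnTree

namespace LTerm

/-- The states in the generation of a clocked Böhm tree: `eval M` is the root of the clocked Böhm
tree of `M`; `frame H` is an unannotated node inside a head normal form, where `H` is the subterm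
of the head normal form at that node and the arguments in `H` remain to be evaluated. -/
inductive BTState : Type
  | eval (M : LTerm) : BTState
  | frame (H : LTerm) : BTState

/-- The root symbol of a term. -/
def rootSym : LTerm → NodeSym
  | var i => NodeSym.var i
  | lam _ => NodeSym.lam
  | app _ _ => NodeSym.app

/-- The states at the children of a part of a head normal form: arguments are to be evaluated. -/
def frameChild : LTerm → Fin 3 → Option BTState
  | lam H, 0 => some (BTState.frame H)
  | app A _, 1 => some (BTState.frame A)
  | app _ B, 2 => some (BTState.eval B)
  | _, _ => none

/-- The length of the head reduction of `M` to head normal form, and that head normal form. It is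
meant for terms `M` that have a head normal form: then such a head reduction exists, and it is
unique because head reduction is deterministic and stops at head normal forms. -/
noncomputable def headReduct (M : LTerm) : ℕ × LTerm :=
  @Classical.epsilon _ ⟨(0, M)⟩ fun kH => HeadRed kH.1 M kH.2 ∧ IsHnf kH.2

open Classical in
/-- Evaluation of a state: `none` stands for `⊥` (no head normal form), and `some (a, H)` for a
part `H` of a head normal form with the optional annotation `a`. If `M` reduces to head normal form `H` by `k`
head steps, then `eval M` becomes `H` with annotation `k` at its root. -/
noncomputable def resolve : BTState → Option (Option ℕ × LTerm)
  | BTState.eval M => if HasHnf M then some (some (headReduct M).1, (headReduct M).2) else none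
  | BTState.frame H => some (none, H)

/-- The annotated term generated by a state. -/
noncomputable def unfold : BTState → AnnTree
  | s, [] =>
    match resolve s with
    | none => some ⟨NodeSym.bot, none⟩
    | some (a, H) => some ⟨rootSym H, a⟩
  | s, i :: p =>
    match resolve s with
    | none => none
    | some (_, H) => (frameChild H i).bind fun s' => unfold s' p

/-- The clocked Böhm tree of `M`: it is `⊥` if `M` has no head normal form; otherwise, if `M`
reduces by `k` head steps to the head normal form `λx₁ … λxₙ. y M₁ … Mₘ`, it is that term, annotated
by `k` at the root, with each `Mᵢ` replaced by its clocked Böhm tree. -/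
noncomputable def clockedBT (M : LTerm) : AnnTree := unfold (BTState.eval M)

/-- `M` improves `N` eventually: the annotations of the clocked Böhm tree of `M` are eventually at
most those of the clocked Böhm tree of `N`. -/
def ImprovesEventually (M N : LTerm) : Prop :=
  AnnTree.RelEventually (· ≤ ·) (clockedBT M) (clockedBT N)

end LTerm

/-!
By confluence, convertible terms `M` and `N` have a common reduct `P`. Head reduction can only get
shorter along `N ↠ P`, so it suffices to compare `M` with `P`. Take a standard reduction `M ↠ P`.
Contracting a simple redex creates no new copies of the steps of this standard reduction: a linear
redex copies its argument at most once, and a call-by-value redex copies an argument in which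
nothing is left to contract. Hence every head step of `M` is either a head step of `P` or one of the
finitely many steps of the standard reduction, which is then used up. The length of the standard
reduction thus bounds the number of nodes at which the clock of `M` exceeds that of `N`, and
finitely many nodes have bounded depth.
-/

namespace LTerm

/-! ### Substitution -/

theorem upSub_comp_upRen (ξ : ℕ → ℕ) (σ : ℕ → LTerm) : upSub σ ∘ upRen ξ = upSub (σ ∘ ξ) := by
  funext i
  cases i <;> rfl

theorem upSub_var_comp (ξ : ℕ → ℕ) : upSub (var ∘ ξ) = var ∘ upRen ξ := by
  funext i
  cases i <;> rfl

theorem upSub_var : upSub var = var := by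
  funext i
  cases i <;> rfl

theorem rename_eq_subst (ξ : ℕ → ℕ) (M : LTerm) : M.rename ξ = M.subst (var ∘ ξ) := by
  induction M generalizing ξ with
  | var i => rfl
  | lam M ih => simp only [rename, subst, ih, upSub_var_comp]
  | app M N ihM ihN => simp only [rename, subst, ihM, ihN]

theorem subst_rename (ξ : ℕ → ℕ) (σ : ℕ → LTerm) (M : LTerm) :
    (M.rename ξ).subst σ = M.subst (σ ∘ ξ) := by
  induction M generalizing ξ σ with
  | var i => rfl
  | lam M ih => simp only [rename, subst, ih, upSub_comp_upRen]
  | app M N ihM ihN => simp only [rename, subst, ihM, ihN]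

theorem rename_upSub (ξ : ℕ → ℕ) (σ : ℕ → LTerm) :
    rename (upRen ξ) ∘ upSub σ = upSub (rename ξ ∘ σ) := by
  funext i
  cases i with
  | zero => rfl
  | succ i => simp only [Function.comp_apply, upSub, rename_eq_subst (upRen ξ),
      rename_eq_subst Nat.succ ((σ i).rename ξ), subst_rename]; rfl

theorem rename_subst (ξ : ℕ → ℕ) (σ : ℕ → LTerm) (M : LTerm) :
    (M.subst σ).rename ξ = M.subst (rename ξ ∘ σ) := by
  induction M generalizing ξ σ with
  | var i => rfl
  | lam M ih => simp only [rename, subst, ih, rename_upSub]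
  | app M N ihM ihN => simp only [rename, subst, ihM, ihN]

theorem subst_upSub (σ τ : ℕ → LTerm) : subst (upSub τ) ∘ upSub σ = upSub (subst τ ∘ σ) := by
  funext i
  cases i with
  | zero => rfl
  | succ i => simp only [Function.comp_apply, upSub, subst_rename, rename_subst]; rfl

theorem subst_subst (σ τ : ℕ → LTerm) (M : LTerm) :
    (M.subst σ).subst τ = M.subst (subst τ ∘ σ) := by
  induction M generalizing σ τ with
  | var i => rfl
  | lam M ih => simp only [subst, ih, subst_upSub]
  | app M N ihM ihN => simp only [subst, ihM, ihN]

theorem subst_var (M : LTerm) : M.subst var = M := by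
  induction M with
  | var i => rfl
  | lam M ih => simp only [subst, upSub_var, ih]
  | app M N ihM ihN => simp only [subst, ihM, ihN]

theorem subst_inst (σ : ℕ → LTerm) (P Q : LTerm) :
    (P.inst Q).subst σ = (P.subst (upSub σ)).inst (Q.subst σ) := by
  simp only [inst, subst_subst]
  congr 1
  funext i
  cases i with
  | zero => rfl
  | succ i =>
    simp only [Function.comp_apply, upSub, subst_rename, single, subst]
    exact (subst_var _).symm

theorem rename_inst (ξ : ℕ → ℕ) (P Q : LTerm) :
    (P.inst Q).rename ξ = (P.rename (upRen ξ)).inst (Q.rename ξ) := by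
  simp only [rename_eq_subst, subst_inst, upSub_var_comp]

section PointwiseRelations

variable {R : LTerm → LTerm → Prop}

theorem forall_upSub {σ τ : ℕ → LTerm} (hvar : ∀ i, R (var i) (var i))
    (hren : ∀ {M N}, R M N → R (M.rename Nat.succ) (N.rename Nat.succ)) (h : ∀ i, R (σ i) (τ i)) :
    ∀ i, R (upSub σ i) (upSub τ i)
  | 0 => hvar 0
  | i + 1 => hren (h i)

theorem forall_single {M N : LTerm} (hvar : ∀ i, R (var i) (var i)) (h : R M N) :
    ∀ i, R (single M i) (single N i)
  | 0 => h
  | i + 1 => hvar i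

end PointwiseRelations

/-! ### Occurrences -/

theorem occ_rename {ξ : ℕ → ℕ} {x y : ℕ} (h : ∀ i, occ x (var (ξ i)) = occ y (var i)) (M : LTerm) :
    occ x (M.rename ξ) = occ y M := by
  induction M generalizing ξ x y with
  | var i => exact h i
  | lam _ ih =>
    refine ih fun i => ?_
    cases i with
    | zero => simp [upRen, occ]
    | succ i => simpa [upRen, occ] using h i
  | app M N ihM ihN => simp only [rename, occ, ihM h, ihN h]

theorem occ_rename_succ (x : ℕ) (M : LTerm) : occ (x + 1) (M.rename Nat.succ) = occ x M :=
  occ_rename (fun i => by simp [occ]) M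

theorem occ_subst {σ : ℕ → LTerm} {x y z n : ℕ}
    (h : ∀ i, occ x (σ i) = occ y (var i) + occ z (var i) * n) (M : LTerm) :
    occ x (M.subst σ) = occ y M + occ z M * n := by
  induction M generalizing σ x y z with
  | var i => exact h i
  | lam _ ih =>
    refine ih fun i => ?_
    cases i with
    | zero => simp [upSub, occ]
    | succ i => simpa [upSub, occ_rename_succ, occ] using h i
  | app M N ihM ihN =>
    simp only [subst, occ, ihM h, ihN h]
    ring

theorem occ_inst (P Q : LTerm) (x : ℕ) :
    occ x (P.inst Q) = occ (x + 1) P + occ 0 P * occ x Q := by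
  refine occ_subst (fun i => ?_) P
  cases i <;> simp [single, occ]

theorem occ_le_occ_subst {σ : ℕ → LTerm} {x y : ℕ} (h : 1 ≤ occ x (σ y)) (M : LTerm) :
    occ y M ≤ occ x (M.subst σ) := by
  induction M generalizing σ x y with
  | var i =>
    simp only [subst, occ]
    split_ifs with hi
    · exact hi ▸ h
    · exact Nat.zero_le _
  | lam _ ih => exact ih (by simpa only [upSub, occ_rename_succ] using h)
  | app M N ihM ihN => exact Nat.add_le_add (ihM h) (ihN h)

theorem occ_zero_le_occ_subst_upSub (σ : ℕ → LTerm) (P : LTerm) :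
    occ 0 P ≤ occ 0 (P.subst (upSub σ)) :=
  occ_le_occ_subst (by simp [upSub, occ]) P

/-! ### Reduction and normal forms -/

theorem Step.red {M N : LTerm} (h : Step M N) : Red M N :=
  Relation.ReflTransGen.single h

theorem Red.refl (M : LTerm) : Red M M :=
  Relation.ReflTransGen.refl

theorem Red.trans {M N P : LTerm} (h : Red M N) (h' : Red N P) : Red M P :=
  Relation.ReflTransGen.trans h h'

theorem Red.lam {M N : LTerm} (h : Red M N) : Red M.lam N.lam :=
  Relation.ReflTransGen.lift LTerm.lam (fun _ _ => Step.lam) _ _ h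

theorem Red.app {M M' N N' : LTerm} (hM : Red M M') (hN : Red N N') :
    Red (M.app N) (M'.app N') :=
  Red.trans (Relation.ReflTransGen.lift (fun K : LTerm => K.app N) (fun _ _ => Step.appL N) _ _ hM)
    (Relation.ReflTransGen.lift M'.app (fun _ _ => Step.appR M') _ _ hN)

theorem Step.subst {M N : LTerm} (h : Step M N) (σ : ℕ → LTerm) :
    Step (M.subst σ) (N.subst σ) := by
  induction h generalizing σ with
  | beta M N => rw [subst_inst]; exact .beta _ _
  | lam _ ih => exact .lam (ih _)
  | appL N _ ih => exact .appL _ (ih _)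
  | appR M _ ih => exact .appR _ (ih _)

theorem Red.subst {M N : LTerm} (h : Red M N) (σ : ℕ → LTerm) : Red (M.subst σ) (N.subst σ) :=
  Relation.ReflTransGen.lift (LTerm.subst σ) (fun _ _ hs => Step.subst hs σ) _ _ h

theorem Red.rename {M N : LTerm} (h : Red M N) (ξ : ℕ → ℕ) : Red (M.rename ξ) (N.rename ξ) := by
  simpa only [rename_eq_subst] using h.subst _

theorem red_subst_of_forall_red {σ τ : ℕ → LTerm} (h : ∀ i, Red (σ i) (τ i)) (M : LTerm) :
    Red (M.subst σ) (M.subst τ) := by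
  induction M generalizing σ τ with
  | var i => exact h i
  | lam M ih => exact (ih (forall_upSub (fun _ => .refl _) (·.rename _) h)).lam
  | app M N ihM ihN => exact (ihM h).app (ihN h)

theorem Red.inst {P P' Q Q' : LTerm} (hP : Red P P') (hQ : Red Q Q') :
    Red (P.inst Q) (P'.inst Q') :=
  (hP.subst _).trans (red_subst_of_forall_red (forall_single (fun _ => .refl _) hQ) P')

theorem Red.eq_of_isNormal {M N : LTerm} (h : Red M N) (hM : IsNormal M) : N = M := by
  rcases Relation.ReflTransGen.cases_head h with h | ⟨X, hX, -⟩
  · exact h.symm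
  · exact absurd hX (hM X)

theorem IsNormal.of_subst {M : LTerm} {σ : ℕ → LTerm} (h : IsNormal (M.subst σ)) : IsNormal M :=
  fun _ hs => h _ (hs.subst σ)

theorem IsNormal.of_rename {M : LTerm} {ξ : ℕ → ℕ} (h : IsNormal (M.rename ξ)) : IsNormal M :=
  IsNormal.of_subst (rename_eq_subst ξ M ▸ h)

theorem IsNormal.occ_eq_zero {M : LTerm} {σ : ℕ → LTerm} {x : ℕ} (h : IsNormal (M.subst σ))
    (hx : ¬ IsNormal (σ x)) : occ x M = 0 := by
  induction M generalizing σ x with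
  | var i => exact if_neg fun hi : x = i => hx (hi ▸ h)
  | lam M ih => exact ih (fun _ hs => h _ (.lam hs)) fun hn => hx hn.of_rename
  | app M N ihM ihN =>
    exact Nat.add_eq_zero_iff.2
      ⟨ihM (fun _ hs => h _ (.appL _ hs)) hx, ihN (fun _ hs => h _ (.appR _ hs)) hx⟩

theorem Red.of_var {i : ℕ} {P : LTerm} (h : Red (.var i) P) : P = .var i :=
  h.eq_of_isNormal fun _ hs => by cases hs

theorem Red.of_lam {A P : LTerm} (h : Red A.lam P) : ∃ A', P = A'.lam ∧ Red A A' := by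
  induction h with
  | refl => exact ⟨A, rfl, .refl A⟩
  | tail _ hs ih =>
    obtain ⟨A', rfl, hA⟩ := ih
    cases hs with
    | lam hs => exact ⟨_, rfl, hA.trans hs.red⟩

/-! ### Confluence -/

/-- Parallel `β`-reduction: any set of redexes of a term is contracted simultaneously. It has the
diamond property, from which confluence of `β`-reduction follows. -/
inductive Par : LTerm → LTerm → Prop
  | var (i : ℕ) : Par (var i) (var i)
  | lam {M M' : LTerm} (h : Par M M') : Par (lam M) (lam M')
  | app {M M' N N' : LTerm} (hM : Par M M') (hN : Par N N') : Par (app M N) (app M' N')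
  | beta {M M' N N' : LTerm} (hM : Par M M') (hN : Par N N') :
      Par (app (lam M) N) (M'.inst N')

theorem Par.refl (M : LTerm) : Par M M := by
  induction M with
  | var i => exact .var i
  | lam M ih => exact .lam ih
  | app M N ihM ihN => exact .app ihM ihN

theorem Step.par {M N : LTerm} (h : Step M N) : Par M N := by
  induction h with
  | beta M N => exact .beta (.refl M) (.refl N)
  | lam _ ih => exact .lam ih
  | appL N _ ih => exact .app ih (.refl N)
  | appR M _ ih => exact .app (.refl M) ih

theorem Par.red {M N : LTerm} (h : Par M N) : Red M N := by
  induction h with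
  | var i => exact .refl _
  | lam _ ih => exact ih.lam
  | app _ _ ihM ihN => exact ihM.app ihN
  | beta _ _ ihM ihN => exact (Step.beta _ _).red.trans (ihM.inst ihN)

theorem reflTransGen_par_eq_red : Relation.ReflTransGen Par = Red :=
  le_antisymm (Relation.reflTransGen_closed fun _ _ => Par.red)
    (Relation.ReflTransGen.mono fun _ _ => Step.par)

theorem Par.rename {M N : LTerm} (h : Par M N) (ξ : ℕ → ℕ) : Par (M.rename ξ) (N.rename ξ) := by
  induction h generalizing ξ with
  | var i => exact .var _
  | lam _ ih => exact .lam (ih _)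
  | app _ _ ihM ihN => exact .app (ihM _) (ihN _)
  | beta _ _ ihM ihN => rw [rename_inst]; exact .beta (ihM _) (ihN _)

theorem Par.subst {M N : LTerm} (h : Par M N) {σ τ : ℕ → LTerm} (hστ : ∀ i, Par (σ i) (τ i)) :
    Par (M.subst σ) (N.subst τ) := by
  induction h generalizing σ τ with
  | var i => exact hστ i
  | lam _ ih => exact .lam (ih (forall_upSub .var (·.rename _) hστ))
  | app _ _ ihM ihN => exact .app (ihM hστ) (ihN hστ)
  | beta _ _ ihM ihN =>
    rw [subst_inst]
    exact .beta (ihM (forall_upSub .var (·.rename _) hστ)) (ihN hστ)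

theorem Par.inst {P P' Q Q' : LTerm} (hP : Par P P') (hQ : Par Q Q') :
    Par (P.inst Q) (P'.inst Q') :=
  hP.subst (forall_single .var hQ)

/-- The complete development of a term, which contracts all of its redexes simultaneously. It is a
common parallel reduct of all parallel reducts of the term. -/
def completeDev : LTerm → LTerm
  | var i => var i
  | lam M => lam (completeDev M)
  | app (lam M) N => (completeDev M).inst (completeDev N)
  | app M N => app (completeDev M) (completeDev N)

theorem Par.completeDev {M N : LTerm} (h : Par M N) : Par N M.completeDev := by
  induction h with
  | var i => exact .var i
  | lam _ ih => exact .lam ih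
  | @app M M' N N' hM _ ihM ihN =>
    cases M with
    | lam A =>
      cases hM with
      | lam hA => cases ihM with
        | lam ihA => exact .beta ihA ihN
    | var i => exact .app ihM ihN
    | app M₁ M₂ => exact .app ihM ihN
  | beta _ _ ihM ihN => exact ihM.inst ihN

theorem Conv.exists_red {M N : LTerm} (h : Conv M N) : ∃ P, Red M P ∧ Red N P := by
  have diamond : ∀ a b c, Par a b → Par a c →
      ∃ d, Relation.ReflGen Par b d ∧ Relation.ReflTransGen Par c d := fun a _ _ hb hc =>
    ⟨a.completeDev, .single hb.completeDev, .single hc.completeDev⟩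
  have join_equiv := Relation.equivalence_join_reflTransGen diamond
  have step_le_join : ∀ a b, Step a b → Relation.Join (Relation.ReflTransGen Par) a b :=
    fun _ b hs => ⟨b, .single hs.par, .refl⟩
  have := join_equiv.eqvGen_iff.1 (Relation.EqvGen.mono step_le_join _ _ h)
  rwa [reflTransGen_par_eq_red] at this

/-! ### Weak head reduction -/

section RelPow

variable {α β : Type*} {R : α → α → Prop} {S : β → β → Prop} {a b c : α} {j k : ℕ}

/-- `RelPow R k a b`: a chain of exactly `k` steps of `R` leads from `a` to `b`. It counts the steps
of a reduction. -/
inductive RelPow (R : α → α → Prop) : ℕ → α → α → Prop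
  | refl (a : α) : RelPow R 0 a a
  | step {k : ℕ} {a b c : α} (h : R a b) (h' : RelPow R k b c) : RelPow R (k + 1) a c

theorem RelPow.single (h : R a b) : RelPow R 1 a b :=
  .step h (.refl b)

theorem RelPow.trans (h : RelPow R j a b) (h' : RelPow R k b c) : RelPow R (j + k) a c := by
  induction h with
  | refl => rwa [Nat.zero_add]
  | step h _ ih =>
    rw [Nat.add_right_comm]
    exact .step h (ih h')

theorem RelPow.lift (f : α → β) (hf : ∀ a b, R a b → S (f a) (f b)) (h : RelPow R k a b) :
    RelPow S k (f a) (f b) := by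
  induction h with
  | refl => exact .refl _
  | step h _ ih => exact .step (hf _ _ h) ih

theorem RelPow.reflTransGen (h : RelPow R k a b) : Relation.ReflTransGen R a b := by
  induction h with
  | refl => exact .refl
  | step h _ ih => exact ih.head h

theorem RelPow.eq_of_forall_not (h : RelPow R k a b) (ha : ∀ c, ¬ R a c) : k = 0 ∧ b = a := by
  cases h with
  | refl => exact ⟨rfl, rfl⟩
  | step h _ => exact absurd h (ha _)

theorem RelPow.right_unique (hR : Relator.RightUnique R) (hb : RelPow R j a b) (hc : RelPow R k a c)
    (hb' : ∀ d, ¬ R b d) (hc' : ∀ d, ¬ R c d) : j = k ∧ b = c := by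
  induction hb generalizing k with
  | refl =>
    obtain ⟨rfl, rfl⟩ := hc.eq_of_forall_not hb'
    exact ⟨rfl, rfl⟩
  | step h _ ih =>
    cases hc with
    | refl => exact absurd h (hc' _)
    | step h' hc =>
      obtain rfl := hR h h'
      obtain ⟨rfl, rfl⟩ := ih hc hb'
      exact ⟨rfl, rfl⟩

end RelPow

/-- A weak head step, that is, a head step that is not below an abstraction, whose redex
`(λx.P) Q` satisfies `G P Q`. -/
inductive WeakHeadStep (G : LTerm → LTerm → Prop) : LTerm → LTerm → Prop
  | beta {P Q : LTerm} (h : G P Q) : WeakHeadStep G (app (lam P) Q) (P.inst Q)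
  | appL {M M' : LTerm} (N : LTerm) (h : WeakHeadStep G M M') :
      WeakHeadStep G (app M N) (app M' N)

section WeakHeadStep

variable {G G' : LTerm → LTerm → Prop} {M M' N N' : LTerm}

theorem WeakHeadStep.mono (hG : G ≤ G') (h : WeakHeadStep G M N) : WeakHeadStep G' M N := by
  induction h with
  | beta h => exact .beta (hG _ _ h)
  | appL N _ ih => exact .appL N ih

theorem WeakHeadStep.step (h : WeakHeadStep G M N) : Step M N := by
  induction h with
  | beta _ => exact .beta _ _
  | appL N _ ih => exact .appL N ih

theorem not_weakHeadStep_lam : ¬ WeakHeadStep G M.lam N := nofun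

theorem WeakHeadStep.right_unique (h : WeakHeadStep G M N) (h' : WeakHeadStep G' M N') :
    N = N' := by
  induction h generalizing N' with
  | beta _ =>
    cases h' with
    | beta _ => rfl
    | appL _ h' => exact absurd h' not_weakHeadStep_lam
  | appL N h ih =>
    cases h' with
    | beta _ => exact absurd h not_weakHeadStep_lam
    | appL _ h' => rw [ih h']

theorem WeakHeadStep.not_compl (h : WeakHeadStep G M N) : ¬ WeakHeadStep Gᶜ M N' := by
  intro h'
  induction h generalizing N' with
  | beta hG =>
    cases h' with
    | beta hG' => exact hG' hG
    | appL _ h' => exact not_weakHeadStep_lam h'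
  | appL N h ih =>
    cases h' with
    | beta _ => exact not_weakHeadStep_lam h
    | appL _ h' => exact ih h'

theorem WeakHeadStep.subst {σ : ℕ → LTerm}
    (hG : ∀ P Q, G P Q → G' (P.subst (upSub σ)) (Q.subst σ)) (h : WeakHeadStep G M N) :
    WeakHeadStep G' (M.subst σ) (N.subst σ) := by
  induction h with
  | beta h =>
    rw [subst_inst]
    exact .beta (hG _ _ h)
  | appL N _ ih => exact .appL _ ih

end WeakHeadStep

/-- Weak head reduction with the number of its steps. -/
abbrev WeakHeadRed : ℕ → LTerm → LTerm → Prop := RelPow (WeakHeadStep ⊤)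

theorem WeakHeadRed.red {k : ℕ} {M N : LTerm} (h : WeakHeadRed k M N) : Red M N :=
  Relation.ReflTransGen.mono (fun _ _ => WeakHeadStep.step) _ _ h.reflTransGen

theorem WeakHeadRed.subst {k : ℕ} {M N : LTerm} (h : WeakHeadRed k M N) (σ : ℕ → LTerm) :
    WeakHeadRed k (M.subst σ) (N.subst σ) :=
  h.lift (LTerm.subst σ) fun _ _ hs => hs.subst fun _ _ => id

theorem WeakHeadRed.appL {k : ℕ} {M N : LTerm} (h : WeakHeadRed k M N) (K : LTerm) :
    WeakHeadRed k (M.app K) (N.app K) :=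
  h.lift (fun X : LTerm => X.app K) fun _ _ => .appL K

theorem WeakHeadRed.of_lam {k : ℕ} {A N : LTerm} (h : WeakHeadRed k A.lam N) :
    k = 0 ∧ N = A.lam :=
  h.eq_of_forall_not fun _ => not_weakHeadStep_lam

theorem WeakHeadRed.cases_of_weakHeadStep {G : LTerm → LTerm → Prop} {k : ℕ} {M M₁ N : LTerm}
    (h : WeakHeadRed k M N) (hs : WeakHeadStep G M M₁) :
    (k = 0 ∧ N = M) ∨ ∃ j, k = j + 1 ∧ WeakHeadRed j M₁ N := by
  cases h with
  | refl => exact .inl ⟨rfl, rfl⟩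
  | step h hN => exact .inr ⟨_, rfl, hs.right_unique h ▸ hN⟩

/-- The weak head reduction of `M` contracts some redex that is not simple. -/
def WeakNonsimple (M : LTerm) : Prop :=
  ∃ k X Y, WeakHeadRed k M X ∧ WeakHeadStep SimpleRedexᶜ X Y

theorem WeakNonsimple.of_weakHeadRed {k : ℕ} {M N : LTerm} (h : WeakHeadRed k M N)
    (hN : WeakNonsimple N) : WeakNonsimple M := by
  obtain ⟨j, X, Y, hX, hY⟩ := hN
  exact ⟨_, X, Y, h.trans hX, hY⟩

theorem SimpleRedex.of_subst {P Q : LTerm} {σ : ℕ → LTerm}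
    (h : SimpleRedex (P.subst (upSub σ)) (Q.subst σ)) : SimpleRedex P Q :=
  h.imp (occ_zero_le_occ_subst_upSub σ P).trans IsNormal.of_subst

theorem WeakNonsimple.subst {M : LTerm} (h : WeakNonsimple M) (σ : ℕ → LTerm) :
    WeakNonsimple (M.subst σ) := by
  obtain ⟨j, X, Y, hX, hY⟩ := h
  exact ⟨j, _, _, hX.subst σ, hY.subst fun _ _ h h' => h h'.of_subst⟩

theorem WeakNonsimple.appL {M : LTerm} (h : WeakNonsimple M) (K : LTerm) :
    WeakNonsimple (M.app K) := by
  obtain ⟨j, X, Y, hX, hY⟩ := h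
  exact ⟨j, _, _, hX.appL K, .appL K hY⟩

theorem not_weakNonsimple_of_relPow {k : ℕ} {M X : LTerm}
    (h : RelPow (WeakHeadStep SimpleRedex) k M X) (hX : ∀ Y, ¬ WeakHeadStep ⊤ X Y) :
    ¬ WeakNonsimple M := by
  rintro ⟨j, Y, Z, hY, hZ⟩
  induction h generalizing j with
  | refl M =>
    obtain ⟨-, rfl⟩ := hY.eq_of_forall_not hX
    exact hX Z (hZ.mono le_top)
  | step hs _ ih =>
    obtain ⟨-, rfl⟩ | ⟨i, -, hY'⟩ := WeakHeadRed.cases_of_weakHeadStep hY hs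
    · exact hs.not_compl hZ
    · exact ih hX i hY'

theorem not_weakNonsimple_lam {A : LTerm} : ¬ WeakNonsimple A.lam :=
  not_weakNonsimple_of_relPow (.refl _) fun _ => not_weakHeadStep_lam

/-! ### Standard reduction -/

/-- Standard reduction from `M` to `P`, built up along the structure of `P`. The weight `w` bounds
the number of its weak head steps, but if the weak head reduction of a term contracts a redex that
is not simple, then all steps inside that term count for nothing. -/
inductive StdRed : ℕ → LTerm → LTerm → Prop
  | var {w k : ℕ} {M : LTerm} {i : ℕ} (h : WeakHeadRed k M (var i))
      (hw : ¬ WeakNonsimple M → k ≤ w) : StdRed w M (var i)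
  | lam {w k a : ℕ} {M A A' : LTerm} (h : WeakHeadRed k M (lam A)) (hA : StdRed a A A')
      (hw : ¬ WeakNonsimple M → k + a ≤ w) : StdRed w M (lam A')
  | app {w k a b : ℕ} {M A A' B B' : LTerm} (h : WeakHeadRed k M (app A B)) (hA : StdRed a A A')
      (hB : StdRed b B B') (hw : ¬ WeakNonsimple M → k + (a + b) ≤ w) : StdRed w M (app A' B')

theorem StdRed.mono {v w : ℕ} {M N : LTerm} (h : StdRed v M N)
    (hvw : ¬ WeakNonsimple M → v ≤ w) : StdRed w M N := by
  cases h with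
  | var h hw => exact .var h fun hM => (hw hM).trans (hvw hM)
  | lam h hA hw => exact .lam h hA fun hM => (hw hM).trans (hvw hM)
  | app h hA hB hw => exact .app h hA hB fun hM => (hw hM).trans (hvw hM)

theorem StdRed.lam_congr {a : ℕ} {A A' : LTerm} (h : StdRed a A A') : StdRed a A.lam A'.lam :=
  .lam (.refl _) h fun _ => (Nat.zero_add a).le

theorem StdRed.app_congr {a b : ℕ} {A A' B B' : LTerm} (hA : StdRed a A A') (hB : StdRed b B B') :
    StdRed (a + b) (A.app B) (A'.app B') :=
  .app (.refl _) hA hB fun _ => (Nat.zero_add _).le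

theorem StdRed.refl (M : LTerm) : StdRed 0 M M := by
  induction M with
  | var i => exact .var (.refl _) fun _ => le_rfl
  | lam M ih => exact ih.lam_congr
  | app M N ihM ihN => exact ihM.app_congr ihN

theorem StdRed.red {w : ℕ} {M N : LTerm} (h : StdRed w M N) : Red M N := by
  induction h with
  | var h _ => exact h.red
  | lam h _ _ ih => exact h.red.trans ih.lam
  | app h _ _ _ ihA ihB => exact h.red.trans (ihA.app ihB)

theorem StdRed.of_weakHeadRed {k w : ℕ} {M X P : LTerm} (h : WeakHeadRed k M X)
    (hX : StdRed w X P) : StdRed (k + w) M P := by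
  have hM : ¬ WeakNonsimple M → ¬ WeakNonsimple X := mt (.of_weakHeadRed h)
  cases hX with
  | var hX hw => exact .var (h.trans hX) fun hn => by have := hw (hM hn); omega
  | lam hX hA hw => exact .lam (h.trans hX) hA fun hn => by have := hw (hM hn); omega
  | app hX hA hB hw => exact .app (h.trans hX) hA hB fun hn => by have := hw (hM hn); omega

theorem StdRed.subst {a : ℕ} {A A' : LTerm} (h : StdRed a A A') (σ : ℕ → LTerm) :
    StdRed a (A.subst σ) (A'.subst σ) := by
  induction h generalizing σ with
  | @var _ _ _ i h hw =>
    exact ((StdRed.refl (σ i)).of_weakHeadRed (h.subst σ)).mono fun hn => hw (mt (·.subst σ) hn)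
  | lam h _ hw ih => exact .lam (h.subst σ) (ih _) fun hn => hw (mt (·.subst σ) hn)
  | app h _ _ hw ihA ihB =>
    exact .app (h.subst σ) (ihA σ) (ihB σ) fun hn => hw (mt (·.subst σ) hn)

theorem StdRed.rename {a : ℕ} {A A' : LTerm} (h : StdRed a A A') (ξ : ℕ → ℕ) :
    StdRed a (A.rename ξ) (A'.rename ξ) := by
  simpa only [rename_eq_subst] using h.subst _

/-- As `σ x` is not normal, a redex of `M.subst σ` whose argument comes from a subterm of `M` that
contains `x` is not call-by-value, so it is linear and copies this subterm at most once. -/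
theorem WeakHeadStep.occ_le {G : LTerm → LTerm → Prop} {σ : ℕ → LTerm} {x : ℕ} {M N : LTerm}
    (h : WeakHeadStep G M N) (hx : ¬ IsNormal (σ x)) (hM : ¬ WeakNonsimple (M.subst σ)) :
    occ x N ≤ occ x M := by
  induction h with
  | @beta P Q _ =>
    have simple : SimpleRedex (P.subst (upSub σ)) (Q.subst σ) :=
      by_contra fun hn => hM ⟨0, _, _, .refl _, .beta hn⟩
    rw [occ_inst]
    refine Nat.add_le_add_left ?_ _
    rcases simple with linear | cbv
    · exact mul_le_of_le_one_left (Nat.zero_le _) ((occ_zero_le_occ_subst_upSub σ P).trans linear)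
    · rw [IsNormal.occ_eq_zero cbv hx, Nat.mul_zero]
  | appL N _ ih => exact Nat.add_le_add_right (ih (mt (·.appL _) hM)) _

theorem WeakHeadRed.occ_le {σ : ℕ → LTerm} {x k : ℕ} {M N : LTerm} (h : WeakHeadRed k M N)
    (hx : ¬ IsNormal (σ x)) (hM : ¬ WeakNonsimple (M.subst σ)) : occ x N ≤ occ x M := by
  induction h with
  | refl => exact le_rfl
  | step h _ ih =>
    exact (ih (mt (.of_weakHeadRed (WeakHeadRed.subst (.single h) σ)) hM)).trans (h.occ_le hx hM)

theorem StdRed.subst_of_eq_off {a b x : ℕ} {A A' : LTerm} {σ τ : ℕ → LTerm} (h : StdRed a A A')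
    (hστ : ∀ i, i ≠ x → σ i = τ i) (hb : StdRed b (σ x) (τ x)) (hx : ¬ IsNormal (σ x)) :
    StdRed (a + occ x A * b) (A.subst σ) (A'.subst τ) := by
  induction h generalizing x σ τ with
  | @var w k M i h hw =>
    have hk (hn : ¬ WeakNonsimple (M.subst σ)) : k ≤ w := hw (mt (·.subst σ) hn)
    by_cases hi : i = x
    · subst hi
      refine (hb.of_weakHeadRed (h.subst σ)).mono fun hn => Nat.add_le_add (hk hn) ?_
      have : 1 ≤ occ i M := by simpa [occ] using h.occ_le hx hn
      exact Nat.le_mul_of_pos_left b this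
    · exact ((hστ i hi ▸ StdRed.refl (σ i) : StdRed 0 (σ i) (τ i)).of_weakHeadRed (h.subst σ)).mono
        fun hn => (hk hn).trans (Nat.le_add_right _ _)
  | @lam w k a M A A' h _ hw ih =>
    have hup : ∀ i, i ≠ x + 1 → upSub σ i = upSub τ i := by
      rintro (_ | i) hi
      · rfl
      · simp only [upSub, hστ i (by simpa using hi)]
    refine .lam (h.subst σ) (ih hup (hb.rename _) (mt IsNormal.of_rename hx)) fun hn => ?_
    have hk := hw (mt (·.subst σ) hn)
    have := Nat.mul_le_mul_right b (h.occ_le hx hn)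
    simp only [occ] at this
    omega
  | @app w k a c M A A' B B' h _ _ hw ihA ihB =>
    refine .app (h.subst σ) (ihA hστ hb hx) (ihB hστ hb hx) fun hn => ?_
    have hk := hw (mt (·.subst σ) hn)
    have := Nat.mul_le_mul_right b (h.occ_le hx hn)
    simp only [occ, Nat.add_mul] at this
    omega

theorem StdRed.inst_of_isNormal {a b : ℕ} {A A' B B' : LTerm} (hA : StdRed a A A')
    (hB : StdRed b B B') (hn : IsNormal B) : StdRed a (A.inst B) (A'.inst B') := by
  rw [hB.red.eq_of_isNormal hn]
  exact hA.subst _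

theorem StdRed.inst {a b : ℕ} {A A' B B' : LTerm} (hA : StdRed a A A') (hB : StdRed b B B') :
    StdRed (a + occ 0 A * b) (A.inst B) (A'.inst B') := by
  by_cases hn : IsNormal B
  · exact (hA.inst_of_isNormal hB hn).mono fun _ => Nat.le_add_right _ _
  · refine hA.subst_of_eq_off (x := 0) (fun i hi => ?_) hB hn
    cases i with
    | zero => exact absurd rfl hi
    | succ i => rfl

theorem StdRed.inst_of_simpleRedex {a b : ℕ} {A A' B B' : LTerm} (hA : StdRed a A A')
    (hB : StdRed b B B') (h : SimpleRedex A B) : StdRed (a + b) (A.inst B) (A'.inst B') := by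
  rcases h with linear | cbv
  · have : occ 0 A * b ≤ b := mul_le_of_le_one_left (Nat.zero_le b) linear
    exact (hA.inst hB).mono fun _ => Nat.add_le_add_left this a
  · exact (hA.inst_of_isNormal hB cbv).mono fun _ => Nat.le_add_right a b

theorem StdRed.of_lam {w : ℕ} {A P : LTerm} (h : StdRed w A.lam P) :
    ∃ A', P = A'.lam ∧ StdRed w A A' := by
  cases h with
  | var h _ => cases h.of_lam.2
  | app h _ _ _ => cases h.of_lam.2
  | lam h hA hw =>
    obtain ⟨rfl, h'⟩ := h.of_lam
    cases h'
    exact ⟨_, rfl, hA.mono fun _ => by simpa using hw not_weakNonsimple_lam⟩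

theorem StdRed.exists_tail {w : ℕ} {M N N' : LTerm} (h : StdRed w M N) (hs : Step N N') :
    ∃ v, StdRed v M N' := by
  induction hs generalizing w M with
  | beta C B =>
    cases h with
    | app h hA hB _ => cases hA with
      | lam h' hC _ =>
        have contract : WeakHeadRed _ M _ := h.trans ((h'.appL _).trans (.single (.beta trivial)))
        exact ⟨_, (hC.inst hB).of_weakHeadRed contract⟩
  | lam _ ih =>
    cases h with
    | lam h hA _ => exact (ih hA).imp' _ fun _ hv => hv.lam_congr.of_weakHeadRed h
  | appL N _ ih =>
    cases h with
    | app h hA hB _ => exact (ih hA).imp' _ fun _ hv => (hv.app_congr hB).of_weakHeadRed h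
  | appR N _ ih =>
    cases h with
    | app h hA hB _ => exact (ih hB).imp' _ fun _ hv => (hA.app_congr hv).of_weakHeadRed h

theorem Red.exists_stdRed {M N : LTerm} (h : Red M N) : ∃ w, StdRed w M N := by
  induction h with
  | refl => exact ⟨0, .refl M⟩
  | tail _ hs ih =>
    obtain ⟨_, hw⟩ := ih
    exact hw.exists_tail hs

/-! ### Standard reduction along weak head reduction -/

theorem StdRed.cases_of_weakHeadStep_app {G : LTerm → LTerm → Prop} {w : ℕ} {A B M₁ P : LTerm}
    (h : StdRed w (A.app B) P) (hs : WeakHeadStep G (A.app B) M₁)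
    (hM : ¬ WeakNonsimple (A.app B)) :
    (∃ v, StdRed v M₁ P ∧ v + 1 ≤ w) ∨
      ∃ A' B' a b, P = A'.app B' ∧ StdRed a A A' ∧ StdRed b B B' ∧ a + b ≤ w := by
  cases h with
  | var h hw =>
    obtain ⟨-, ⟨⟩⟩ | ⟨j, rfl, h'⟩ := h.cases_of_weakHeadStep hs
    exact .inl ⟨j, .var h' fun _ => le_rfl, hw hM⟩
  | lam h hA hw =>
    obtain ⟨-, ⟨⟩⟩ | ⟨j, rfl, h'⟩ := h.cases_of_weakHeadStep hs
    exact .inl ⟨_, hA.lam_congr.of_weakHeadRed h', by have := hw hM; omega⟩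
  | app h hA hB hw =>
    have hk := hw hM
    obtain ⟨rfl, ⟨⟩⟩ | ⟨j, rfl, h'⟩ := h.cases_of_weakHeadStep hs
    · exact .inr ⟨_, _, _, _, rfl, hA, hB, by omega⟩
    · exact .inl ⟨_, (hA.app_congr hB).of_weakHeadRed h', by omega⟩

theorem StdRed.weakHeadStep {w : ℕ} {M M₁ P : LTerm} (h : StdRed w M P)
    (hs : WeakHeadStep SimpleRedex M M₁) (hM : ¬ WeakNonsimple M) :
    ∃ j v P₁, WeakHeadRed j P P₁ ∧ StdRed v M₁ P₁ ∧ 1 + v ≤ j + w ∧ v ≤ w := by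
  induction hs generalizing w P with
  | @beta C B hCB =>
    obtain ⟨v, hv, hvw⟩ | ⟨_, B', a, b, rfl, hA, hB, hw⟩ :=
      h.cases_of_weakHeadStep_app (.beta hCB) hM
    · exact ⟨0, v, P, .refl P, hv, by omega, by omega⟩
    · obtain ⟨C', rfl, hC⟩ := hA.of_lam
      exact ⟨1, _, _, .single (.beta trivial), hC.inst_of_simpleRedex hB hCB, by omega, hw⟩
  | @appL A A₁ B hs ih =>
    obtain ⟨v, hv, hvw⟩ | ⟨A', B', a, b, rfl, hA, hB, hw⟩ :=
      h.cases_of_weakHeadStep_app (.appL B hs) hM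
    · exact ⟨0, v, P, .refl P, hv, by omega, by omega⟩
    · obtain ⟨j, v, P₁, hP, hv, hvj, hva⟩ := ih hA (mt (·.appL B) hM)
      exact ⟨j, _, _, hP.appL B', hv.app_congr hB, by omega, by omega⟩

theorem StdRed.weakHeadRed {k w : ℕ} {M M₁ P : LTerm} (h : StdRed w M P)
    (hs : RelPow (WeakHeadStep SimpleRedex) k M M₁) (hM : ¬ WeakNonsimple M) :
    ∃ j v P₁, WeakHeadRed j P P₁ ∧ StdRed v M₁ P₁ ∧ k + v ≤ j + w ∧ v ≤ w := by
  induction hs generalizing w P with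
  | refl => exact ⟨0, w, P, .refl P, h, le_rfl, le_rfl⟩
  | step hs _ ih =>
    obtain ⟨i, u, P₁, hP₁, hu, hui, huw⟩ := h.weakHeadStep hs hM
    obtain ⟨j, v, P₂, hP₂, hv, hvj, hvu⟩ :=
      ih hu (mt (.of_weakHeadRed (.single (hs.mono le_top))) hM)
    exact ⟨i + j, v, P₂, hP₁.trans hP₂, hv, by omega, by omega⟩

/-! ### Reduction along weak head reduction -/

theorem Par.weakHeadStep {M M₁ N : LTerm} (h : Par M N) (hs : WeakHeadStep ⊤ M M₁) :
    ∃ j ≤ 1, ∃ N₁, WeakHeadRed j N N₁ ∧ Par M₁ N₁ := by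
  induction hs generalizing N with
  | beta _ =>
    cases h with
    | app hM hN => cases hM with
      | lam hM => exact ⟨1, le_rfl, _, .single (.beta trivial), hM.inst hN⟩
    | beta hM hN => exact ⟨0, zero_le_one, _, .refl _, hM.inst hN⟩
  | appL K hs ih =>
    cases h with
    | app hM hN =>
      obtain ⟨j, hj, N₁, hN₁, h₁⟩ := ih hM
      exact ⟨j, hj, _, hN₁.appL _, h₁.app hN⟩
    | beta _ _ => exact absurd hs not_weakHeadStep_lam

theorem Par.weakHeadRed {k : ℕ} {M M₁ N : LTerm} (h : Par M N) (hs : WeakHeadRed k M M₁) :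
    ∃ j ≤ k, ∃ N₁, WeakHeadRed j N N₁ ∧ Par M₁ N₁ := by
  induction hs generalizing N with
  | refl => exact ⟨0, le_rfl, N, .refl N, h⟩
  | step hs _ ih =>
    obtain ⟨i, hi, N₁, hN₁, h₁⟩ := h.weakHeadStep hs
    obtain ⟨j, hj, N₂, hN₂, h₂⟩ := ih h₁
    exact ⟨i + j, by omega, N₂, hN₁.trans hN₂, h₂⟩

theorem Red.weakHeadRed {k : ℕ} {M M₁ N : LTerm} (h : Red M N) (hs : WeakHeadRed k M M₁) :
    ∃ j ≤ k, ∃ N₁, WeakHeadRed j N N₁ ∧ Red M₁ N₁ := by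
  induction h with
  | refl => exact ⟨k, le_rfl, M₁, hs, .refl M₁⟩
  | tail _ h ih =>
    obtain ⟨i, hi, N₁, hN₁, h₁⟩ := ih
    obtain ⟨j, hj, N₂, hN₂, h₂⟩ := h.par.weakHeadRed hN₁
    exact ⟨j, hj.trans hi, N₂, hN₂, h₁.trans h₂.red⟩

/-! ### Head normal forms -/

/-- Terms `y N₁ … Nₘ` whose arguments satisfy `X`. -/
inductive Neutral (X : LTerm → Prop) : LTerm → Prop
  | var (y : ℕ) : Neutral X (var y)
  | app {M N : LTerm} (hM : Neutral X M) (hN : X N) : Neutral X (app M N)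

/-- Head normal forms whose arguments satisfy `X`. -/
inductive HeadNormal (X : LTerm → Prop) : LTerm → Prop
  | neutral {M : LTerm} (h : Neutral X M) : HeadNormal X M
  | lam {M : LTerm} (h : HeadNormal X M) : HeadNormal X (lam M)

section HeadNormal

variable {X : LTerm → Prop} {M N : LTerm}

theorem not_neutral_lam : ¬ Neutral X M.lam := nofun

theorem Neutral.apps {Ns : List LTerm} (h : Neutral X M) (hNs : ∀ N ∈ Ns, X N) :
    Neutral X (M.apps Ns) := by
  induction Ns generalizing M with
  | nil => exact h
  | cons N Ns ih =>
    obtain ⟨hN, hNs⟩ := List.forall_mem_cons.1 hNs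
    exact ih (h.app hN) hNs

theorem headNormal_lams_apps (n y : ℕ) {Ns : List LTerm} (h : ∀ N ∈ Ns, X N) :
    HeadNormal X (lams n (apps (var y) Ns)) := by
  induction n with
  | zero => exact .neutral (.apps (.var y) h)
  | succ n ih => exact .lam ih

theorem Neutral.exists_apps (h : Neutral X M) : ∃ y Ns, M = LTerm.apps (LTerm.var y) Ns := by
  induction h with
  | var y => exact ⟨y, [], rfl⟩
  | @app M N _ _ ih =>
    obtain ⟨y, Ns, rfl⟩ := ih
    exact ⟨y, Ns ++ [N], by simp [LTerm.apps]⟩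

theorem HeadNormal.isHnf (h : HeadNormal X M) : IsHnf M := by
  induction h with
  | neutral h =>
    obtain ⟨y, Ns, rfl⟩ := h.exists_apps
    exact ⟨0, y, Ns, rfl⟩
  | lam _ ih =>
    obtain ⟨n, y, Ns, rfl⟩ := ih
    exact ⟨n + 1, y, Ns, rfl⟩

theorem IsHnf.headNormal (h : IsHnf M) : HeadNormal ⊤ M := by
  obtain ⟨n, y, Ns, rfl⟩ := h
  exact headNormal_lams_apps n y fun _ _ => trivial

theorem Neutral.not_weakHeadStep {G : LTerm → LTerm → Prop} (h : Neutral X M) :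
    ¬ WeakHeadStep G M N := by
  intro hs
  induction h generalizing N with
  | var y => cases hs
  | app hM _ ih =>
    cases hs with
    | beta => exact not_neutral_lam hM
    | appL _ hs => exact ih hs

theorem Neutral.step (h : Neutral ⊤ M) (hs : Step M N) : Neutral ⊤ N := by
  induction h generalizing N with
  | var y => cases hs
  | app hM _ ih =>
    cases hs with
    | beta => exact absurd hM not_neutral_lam
    | appL _ hs => exact .app (ih hs) trivial
    | appR _ hs => exact .app hM trivial

theorem Neutral.red (h : Neutral ⊤ M) (hr : Red M N) : Neutral ⊤ N := by
  induction hr with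
  | refl => exact h
  | tail _ hs ih => exact ih.step hs

theorem Red.of_neutral_app {A B P : LTerm} (h : Red (A.app B) P) (hA : Neutral ⊤ A) :
    ∃ A' B', P = A'.app B' ∧ Red A A' ∧ Red B B' := by
  induction h with
  | refl => exact ⟨A, B, rfl, .refl A, .refl B⟩
  | tail _ hs ih =>
    obtain ⟨A', B', rfl, hA', hB'⟩ := ih
    cases hs with
    | beta => exact absurd (hA.red hA') not_neutral_lam
    | appL _ hs => exact ⟨_, _, rfl, hA'.trans hs.red, hB'⟩
    | appR _ hs => exact ⟨_, _, rfl, hA', hB'.trans hs.red⟩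

end HeadNormal

/-! ### Head reduction to head normal form -/

/-- `HeadNormalizes G k M H`: the head reduction of `M` to the head normal form `H` has `k` steps,
and all of its redexes `(λx.P) Q` satisfy `G P Q`. It alternates between weak head reduction to an
abstraction and passing to the body of this abstraction. -/
inductive HeadNormalizes (G : LTerm → LTerm → Prop) : ℕ → LTerm → LTerm → Prop
  | neutral {k : ℕ} {M H : LTerm} (h : RelPow (WeakHeadStep G) k M H) (hH : Neutral ⊤ H) :
      HeadNormalizes G k M H
  | lam {j k : ℕ} {M A H : LTerm} (h : RelPow (WeakHeadStep G) k M (lam A))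
      (hA : HeadNormalizes G j A H) : HeadNormalizes G (k + j) M (lam H)

section HeadNormalizes

variable {G G' : LTerm → LTerm → Prop} {k : ℕ} {M N H : LTerm}

theorem HeadNormalizes.mono (hG : G ≤ G') (h : HeadNormalizes G k M H) :
    HeadNormalizes G' k M H := by
  have weak {j : ℕ} {A B : LTerm} (hAB : RelPow (WeakHeadStep G) j A B) :
      RelPow (WeakHeadStep G') j A B := hAB.lift id fun _ _ hs => hs.mono hG
  induction h with
  | neutral h hH => exact .neutral (weak h) hH
  | lam h _ ih => exact .lam (weak h) ih

theorem HeadNormalizes.of_lam (h : HeadNormalizes G k M.lam H) :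
    ∃ H', H = H'.lam ∧ HeadNormalizes G k M H' := by
  cases h with
  | neutral h hH =>
    obtain ⟨-, rfl⟩ := h.eq_of_forall_not fun _ => not_weakHeadStep_lam
    exact absurd hH not_neutral_lam
  | lam h hA =>
    obtain ⟨rfl, ⟨⟩⟩ := h.eq_of_forall_not fun _ => not_weakHeadStep_lam
    exact ⟨_, rfl, (Nat.zero_add _).symm ▸ hA⟩

theorem HeadNormalizes.of_weakHeadStep (hs : WeakHeadStep G M N) (h : HeadNormalizes G k N H) :
    HeadNormalizes G (k + 1) M H := by
  cases h with
  | neutral h hH => exact .neutral (.step hs h) hH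
  | lam h hA =>
    rw [Nat.add_right_comm]
    exact .lam (.step hs h) hA

theorem WeakHeadStep.apps (h : WeakHeadStep G M N) (Ns : List LTerm) :
    WeakHeadStep G (M.apps Ns) (N.apps Ns) := by
  induction Ns generalizing M N with
  | nil => exact h
  | cons K _ ih => exact ih (h.appL K)

theorem HeadNormalizes.of_redex {n : ℕ} {P Q : LTerm} {Ns : List LTerm} (hPQ : G P Q)
    (h : HeadNormalizes G k (lams n (apps (P.inst Q) Ns)) H) :
    HeadNormalizes G (k + 1) (lams n (apps (P.lam.app Q) Ns)) H := by
  induction n generalizing H with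
  | zero => exact h.of_weakHeadStep ((WeakHeadStep.beta hPQ).apps Ns)
  | succ n ih =>
    obtain ⟨H', rfl, h'⟩ := h.of_lam
    exact Nat.zero_add (k + 1) ▸ .lam (.refl _) (ih h')

theorem HeadNormal.headNormalizes (h : HeadNormal ⊤ H) : HeadNormalizes G 0 H H := by
  induction h with
  | neutral h => exact .neutral (.refl _) h
  | lam _ ih => exact .lam (.refl _) ih

theorem HeadRed.headNormalizes (h : HeadRed k M H) (hH : IsHnf H) : HeadNormalizes ⊤ k M H := by
  induction h with
  | refl => exact hH.headNormal.headNormalizes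
  | step hs _ ih =>
    obtain ⟨n, P, Q, Ns⟩ := hs
    exact (ih hH).of_redex trivial

theorem WeakHeadStep.exists_apps (h : WeakHeadStep G M N) :
    ∃ P Q Ns, M = LTerm.apps (LTerm.app (LTerm.lam P) Q) Ns ∧ N = LTerm.apps (P.inst Q) Ns := by
  induction h with
  | @beta P Q _ => exact ⟨P, Q, [], rfl, rfl⟩
  | appL K _ ih =>
    obtain ⟨P, Q, Ns, rfl, rfl⟩ := ih
    exact ⟨P, Q, Ns ++ [K], by simp [LTerm.apps], by simp [LTerm.apps]⟩

theorem WeakHeadStep.headStep (h : WeakHeadStep G M N) : HeadStep M N := by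
  obtain ⟨P, Q, Ns, rfl, rfl⟩ := h.exists_apps
  exact .mk 0 P Q Ns

theorem HeadStep.lam (h : HeadStep M N) : HeadStep M.lam N.lam := by
  obtain ⟨n, P, Q, Ns⟩ := h
  exact .mk (n + 1) P Q Ns

theorem RelPow.headRed (h : RelPow HeadStep k M N) : HeadRed k M N := by
  induction h with
  | refl => exact .refl _
  | step h _ ih => exact .step h ih

theorem HeadNormalizes.relPow_headStep (h : HeadNormalizes G k M H) : RelPow HeadStep k M H := by
  have weak {j : ℕ} {A B : LTerm} (hAB : RelPow (WeakHeadStep G) j A B) :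
      RelPow HeadStep j A B := hAB.lift id fun _ _ => WeakHeadStep.headStep
  induction h with
  | neutral h _ => exact weak h
  | lam h _ ih => exact (weak h).trans (ih.lift LTerm.lam fun _ _ => HeadStep.lam)

theorem HeadNormalizes.red (h : HeadNormalizes G k M H) : Red M H := by
  have weak {j : ℕ} {A B : LTerm} (hAB : RelPow (WeakHeadStep G) j A B) : Red A B :=
    WeakHeadRed.red (hAB.lift id fun _ _ => .mono le_top)
  induction h with
  | neutral h _ => exact weak h
  | lam h _ ih => exact (weak h).trans ih.lam

theorem HeadNormalizes.headNormal (h : HeadNormalizes G k M H) : HeadNormal ⊤ H := by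
  induction h with
  | neutral _ hH => exact .neutral hH
  | lam _ _ ih => exact .lam ih

theorem HeadNormalizes.right_unique {j : ℕ} {K : LTerm} (h : HeadNormalizes G j M H)
    (h' : HeadNormalizes G k M K) : j = k ∧ H = K := by
  have deterministic : Relator.RightUnique (WeakHeadStep G) := fun _ _ _ hs => hs.right_unique
  induction h generalizing k K with
  | neutral h hH =>
    cases h' with
    | neutral h' hK =>
      exact h.right_unique deterministic h' (fun _ => hH.not_weakHeadStep)
        fun _ => hK.not_weakHeadStep
    | lam h' _ =>
      obtain ⟨-, rfl⟩ :=
        h.right_unique deterministic h' (fun _ => hH.not_weakHeadStep) fun _ => not_weakHeadStep_lam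
      exact absurd hH not_neutral_lam
  | lam h _ ih =>
    cases h' with
    | neutral h' hK =>
      obtain ⟨-, rfl⟩ :=
        h.right_unique deterministic h' (fun _ => not_weakHeadStep_lam) fun _ => hK.not_weakHeadStep
      exact absurd hK not_neutral_lam
    | lam h' hA =>
      obtain ⟨rfl, ⟨⟩⟩ := h.right_unique deterministic h' (fun _ => not_weakHeadStep_lam)
        fun _ => not_weakHeadStep_lam
      obtain ⟨rfl, rfl⟩ := ih hA
      exact ⟨rfl, rfl⟩

theorem HeadNormalizes.headReduct_eq (h : HeadNormalizes ⊤ k M H) : headReduct M = (k, H) := by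
  have headReduct_spec : HeadRed (headReduct M).1 M (headReduct M).2 ∧ IsHnf (headReduct M).2 :=
    Classical.epsilon_spec (p := fun kH : ℕ × LTerm => HeadRed kH.1 M kH.2 ∧ IsHnf kH.2)
      ⟨(k, H), h.relPow_headStep.headRed, h.headNormal.isHnf⟩
  obtain ⟨hk, hH⟩ := (headReduct_spec.1.headNormalizes headReduct_spec.2).right_unique h
  exact Prod.ext hk hH

end HeadNormalizes

theorem StdRed.exists_weakHeadRed_neutral {w : ℕ} {M P : LTerm} (h : StdRed w M P)
    (hP : Neutral ⊤ P) : ∃ k H, WeakHeadRed k M H ∧ Neutral ⊤ H := by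
  induction hP generalizing w M with
  | var y =>
    cases h with
    | var h _ => exact ⟨_, _, h, .var y⟩
  | app _ _ ih =>
    cases h with
    | app h hA _ _ =>
      obtain ⟨k, A, hk, hA'⟩ := ih hA
      exact ⟨_, _, h.trans (hk.appL _), .app hA' trivial⟩

theorem StdRed.exists_headNormalizes {w : ℕ} {M P : LTerm} (h : StdRed w M P)
    (hP : HeadNormal ⊤ P) : ∃ k H, HeadNormalizes ⊤ k M H := by
  induction hP generalizing w M with
  | neutral hP =>
    obtain ⟨k, H, hk, hH⟩ := h.exists_weakHeadRed_neutral hP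
    exact ⟨k, H, .neutral hk hH⟩
  | lam _ ih =>
    cases h with
    | lam h hA _ =>
      obtain ⟨k, H, hH⟩ := ih hA
      exact ⟨_, _, .lam h hH⟩

theorem hasHnf_iff_exists_headNormalizes {M : LTerm} :
    HasHnf M ↔ ∃ k H, HeadNormalizes ⊤ k M H := by
  constructor
  · rintro ⟨P, hP, hnf⟩
    obtain ⟨w, hw⟩ := hP.exists_stdRed
    exact hw.exists_headNormalizes hnf.headNormal
  · rintro ⟨k, H, h⟩
    exact ⟨H, h.red, h.headNormal.isHnf⟩

theorem exists_headNormalizes_of_simpleHeadStep {M H : LTerm}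
    (h : Relation.ReflTransGen SimpleHeadStep M H) (hH : HeadNormal ⊤ H) :
    ∃ k, HeadNormalizes SimpleRedex k M H := by
  induction h using Relation.ReflTransGen.head_induction_on with
  | refl => exact ⟨0, hH.headNormalizes⟩
  | head hs _ ih =>
    obtain ⟨n, P, Q, Ns, hPQ⟩ := hs
    exact ih.imp' (· + 1) fun _ => .of_redex hPQ

theorem Simple.exists_headNormalizes {M : LTerm} (hM : Simple M) (h : HasHnf M) :
    ∃ k H, HeadNormalizes SimpleRedex k M H ∧ HeadNormal Simple H := by
  obtain ⟨X, hX, hMX⟩ := hM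
  obtain ⟨n, y, Ns, hr, hNs⟩ := (hX M hMX).resolve_left (not_not.2 h)
  obtain ⟨k, hk⟩ :=
    exists_headNormalizes_of_simpleHeadStep hr (headNormal_lams_apps n y fun _ _ => trivial)
  exact ⟨k, _, hk, headNormal_lams_apps n y fun N hN => ⟨X, hX, hNs N hN⟩⟩

theorem StdRed.headNormalizes {k w : ℕ} {M H P : LTerm} (h : StdRed w M P)
    (hH : HeadNormalizes SimpleRedex k M H) :
    ∃ j v K, HeadNormalizes ⊤ j P K ∧ StdRed v H K ∧ k + v ≤ j + w ∧ v ≤ w := by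
  induction hH generalizing w P with
  | neutral hs hH =>
    obtain ⟨j, v, K, hK, hv, hvj, hvw⟩ :=
      h.weakHeadRed hs (not_weakNonsimple_of_relPow hs fun _ => hH.not_weakHeadStep)
    exact ⟨j, v, K, .neutral hK (hH.red hv.red), hv, hvj, hvw⟩
  | lam hs _ ih =>
    obtain ⟨i, u, P₁, hP₁, hu, hui, huw⟩ :=
      h.weakHeadRed hs (not_weakNonsimple_of_relPow hs fun _ => not_weakHeadStep_lam)
    obtain ⟨A, rfl, hA⟩ := hu.of_lam
    obtain ⟨j, v, K, hK, hv, hvj, hvu⟩ := ih hA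
    exact ⟨i + j, v, K.lam, .lam hP₁ hK, hv.lam_congr, by omega, by omega⟩

theorem Red.headNormalizes {k : ℕ} {M N H : LTerm} (h : Red M N) (hH : HeadNormalizes ⊤ k M H) :
    ∃ j ≤ k, ∃ K, HeadNormalizes ⊤ j N K ∧ Red H K := by
  induction hH generalizing N with
  | neutral hs hH =>
    obtain ⟨j, hj, K, hK, hr⟩ := h.weakHeadRed hs
    exact ⟨j, hj, K, .neutral hK (hH.red hr), hr⟩
  | lam hs _ ih =>
    obtain ⟨i, hi, N₁, hN₁, hr⟩ := h.weakHeadRed hs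
    obtain ⟨A, rfl, hA⟩ := hr.of_lam
    obtain ⟨j, hj, K, hK, hr'⟩ := ih hA
    exact ⟨i + j, by omega, K.lam, .lam hN₁ hK, hr'.lam⟩

theorem Red.hasHnf_iff {M N : LTerm} (h : Red M N) : HasHnf M ↔ HasHnf N := by
  refine ⟨fun hM => ?_, fun ⟨H, hH, hnf⟩ => ⟨H, h.trans hH, hnf⟩⟩
  obtain ⟨k, H, hH⟩ := hasHnf_iff_exists_headNormalizes.1 hM
  obtain ⟨j, -, K, hK, -⟩ := h.headNormalizes hH
  exact hasHnf_iff_exists_headNormalizes.2 ⟨j, K, hK⟩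

/-! ### Reduction of head normal forms -/

theorem StdRed.of_neutral_app {X : LTerm → Prop} {w : ℕ} {A B P : LTerm} (h : StdRed w (A.app B) P)
    (hn : Neutral X (A.app B)) :
    ∃ A' B' a b, P = A'.app B' ∧ StdRed a A A' ∧ StdRed b B B' ∧ a + b ≤ w := by
  have stuck {k : ℕ} {N : LTerm} (h : WeakHeadRed k (A.app B) N) : k = 0 ∧ N = A.app B :=
    h.eq_of_forall_not fun _ => hn.not_weakHeadStep
  cases h with
  | var h _ => cases (stuck h).2
  | lam h _ _ => cases (stuck h).2
  | app h hA hB hw =>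
    obtain ⟨rfl, ⟨⟩⟩ := stuck h
    have := hw (not_weakNonsimple_of_relPow (.refl _) fun _ => hn.not_weakHeadStep)
    exact ⟨_, _, _, _, rfl, hA, hB, by omega⟩

/-- `Tracks w M N`: a common reduct of `M` and `N` is reached from `M` by a standard reduction of
weight `w`. The weight bounds the number of head steps by which `M`, if it is simple, may in total
be slower than `N` in the clocked Böhm trees. -/
def Tracks (w : ℕ) (M N : LTerm) : Prop := ∃ P, StdRed w M P ∧ Red N P

section Tracks

variable {w : ℕ} {M N : LTerm}

theorem Tracks.hasHnf_iff (h : Tracks w M N) : HasHnf M ↔ HasHnf N := by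
  obtain ⟨P, hM, hN⟩ := h
  exact hM.red.hasHnf_iff.trans hN.hasHnf_iff.symm

theorem Tracks.headNormalizes {j k : ℕ} {H K : LTerm} (h : Tracks w M N)
    (hM : HeadNormalizes SimpleRedex j M H) (hN : HeadNormalizes ⊤ k N K) :
    ∃ v ≤ w, Tracks v H K ∧ j + v ≤ k + w := by
  obtain ⟨P, hMP, hNP⟩ := h
  obtain ⟨i, v, L, hL, hHL, hv, hvw⟩ := hMP.headNormalizes hM
  obtain ⟨i', hi', L', hL', hKL⟩ := hNP.headNormalizes hN
  obtain ⟨rfl, rfl⟩ := hL.right_unique hL'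
  exact ⟨v, hvw, ⟨L, hHL, hKL⟩, by omega⟩

theorem Tracks.of_var {y : ℕ} {K : LTerm} (h : Tracks w (LTerm.var y) K) (hK : HeadNormal ⊤ K) :
    K = LTerm.var y := by
  obtain ⟨P, hP, hr⟩ := h
  obtain rfl := hP.red.of_var
  cases hK with
  | neutral hK =>
    cases hK with
    | var z => exact hr.of_var.symm
    | app hK _ => obtain ⟨_, _, ⟨⟩, -⟩ := hr.of_neutral_app hK
  | lam _ => obtain ⟨_, ⟨⟩, -⟩ := hr.of_lam

theorem Tracks.of_lam {A K : LTerm} (h : Tracks w A.lam K) (hK : HeadNormal ⊤ K) :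
    ∃ A', K = A'.lam ∧ HeadNormal ⊤ A' ∧ Tracks w A A' := by
  obtain ⟨P, hP, hr⟩ := h
  obtain ⟨C, rfl, hC⟩ := hP.of_lam
  cases hK with
  | neutral hK => exact absurd (hK.red hr) not_neutral_lam
  | lam hK =>
    obtain ⟨_, ⟨⟩, hr⟩ := hr.of_lam
    exact ⟨_, rfl, hK, C, hC, hr⟩

theorem Tracks.of_neutral_app {X : LTerm → Prop} {A B K : LTerm} (h : Tracks w (A.app B) K)
    (hn : Neutral X (A.app B)) (hK : HeadNormal ⊤ K) :
    ∃ A' B' a b, K = A'.app B' ∧ HeadNormal ⊤ A' ∧ Tracks a A A' ∧ Tracks b B B' ∧ a + b ≤ w := by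
  obtain ⟨P, hP, hr⟩ := h
  obtain ⟨C, D, a, b, rfl, hC, hD, hw⟩ := hP.of_neutral_app hn
  cases hK with
  | neutral hK =>
    cases hK with
    | var z => cases hr.of_var
    | app hK _ =>
      obtain ⟨_, _, ⟨⟩, hrC, hrD⟩ := hr.of_neutral_app hK
      exact ⟨_, _, a, b, rfl, .neutral hK, ⟨C, hC, hrC⟩, ⟨D, hD, hrD⟩, hw⟩
  | lam _ => obtain ⟨_, ⟨⟩, -⟩ := hr.of_lam

end Tracks

end LTerm

/-! ### Comparison of annotated trees -/

theorem encard_le_of_encard_cons_le {ι : Type*} [Fintype ι] {S : Set (List ι)} {c : ι → ℕ} {w : ℕ}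
    (hc : ∀ i, {p | i :: p ∈ S}.encard ≤ c i) (hw : ∑ i, c i ≤ w)
    (hnil : [] ∈ S → ∑ i, c i < w) : S.encard ≤ w := by
  have tails : (S \ {[]}).encard ≤ (∑ i, c i : ℕ) := by
    have cover : S \ {[]} ⊆ ⋃ i, List.cons i '' {p | i :: p ∈ S} := by
      rintro (_ | ⟨i, p⟩) ⟨hp, hne⟩
      · exact absurd rfl hne
      · exact Set.mem_iUnion.2 ⟨i, p, hp, rfl⟩
    calc (S \ {[]}).encard
      _ ≤ ∑ i, (List.cons i '' {p | i :: p ∈ S}).encard :=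
        (Set.encard_le_encard cover).trans (Set.encard_iUnion_le_of_fintype _)
      _ ≤ ∑ i, (c i : ℕ∞) := Finset.sum_le_sum fun i _ => (Set.encard_image_le _ _).trans (hc i)
      _ = (∑ i, c i : ℕ) := (Nat.cast_sum _ _).symm
  by_cases h : [] ∈ S
  · rw [← Set.encard_sdiff_singleton_add_one h]
    exact (add_le_add_left tails 1).trans (by exact_mod_cast hnil h)
  · rw [← Set.sdiff_singleton_eq_self h]
    exact tails.trans (by exact_mod_cast hw)

theorem finite_of_forall_encard_length_lt_le {ι : Type*} {S : Set (List ι)} {w : ℕ}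
    (h : ∀ d, {p ∈ S | p.length < d}.encard ≤ w) : S.Finite := by
  by_contra infinite
  obtain ⟨F, hFS, hF⟩ := Set.Infinite.exists_subset_card_eq infinite (w + 1)
  have hF' : (F : Set (List ι)) ⊆ {p ∈ S | p.length < F.sup List.length + 1} := fun p hp =>
    ⟨hFS hp, Nat.lt_succ_of_le (Finset.le_sup (f := List.length) hp)⟩
  have : ((w + 1 : ℕ) : ℕ∞) ≤ w :=
    hF ▸ Set.encard_coe_eq_coe_finsetCard F ▸ (Set.encard_le_encard hF').trans (h _)
  exact absurd (by exact_mod_cast this) w.not_succ_le_self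

namespace AnnTree

variable {R : ℕ → ℕ → Prop} {T₁ T₂ : AnnTree} {w : ℕ}

/-- The `i`-th subtree of the root; it has no positions if the root has no such child. -/
def subtree (T : AnnTree) (i : Fin 3) : AnnTree := fun p => T (i :: p)

/-- The positions at which the annotations of `T₁` and `T₂` are not related by `R`. -/
def failures (R : ℕ → ℕ → Prop) (T₁ T₂ : AnnTree) : Set TreePos :=
  {p ∈ T₁.positions | ¬ RelAt R T₁ T₂ p}

theorem failures_self [Std.Refl R] (T : AnnTree) : failures R T T = ∅ := by
  refine Set.eq_empty_of_forall_notMem fun p ⟨hp, hn⟩ => ?_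
  obtain ⟨l, hl⟩ := Option.isSome_iff_exists.1 hp
  refine hn ⟨l, l, hl, hl, ?_⟩
  cases h : l.ann with
  | none => exact .inl ⟨rfl, rfl⟩
  | some k => exact .inr ⟨k, k, rfl, rfl, refl k⟩

/-- The roots of `T₁` and `T₂` carry the same symbol, and the budget `w` covers the budgets at which
`B` relates the subtrees and one more unit if `R` fails at the root. -/
def IsBudgetedStep (R : ℕ → ℕ → Prop) (B : ℕ → AnnTree → AnnTree → Prop) (w : ℕ)
    (T₁ T₂ : AnnTree) : Prop :=
  T₁.deannotate [] = T₂.deannotate [] ∧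
    ∃ c : Fin 3 → ℕ, ∑ i, c i ≤ w ∧ ([] ∈ failures R T₁ T₂ → ∑ i, c i < w) ∧
      ∀ i, B (c i) (T₁.subtree i) (T₂.subtree i)

/-- A simulation between trees with the same symbols in which the budget pays for the failures of
`R`. -/
def IsBudgetedSimulation (R : ℕ → ℕ → Prop) (B : ℕ → AnnTree → AnnTree → Prop) : Prop :=
  ∀ ⦃w T₁ T₂⦄, B w T₁ T₂ → IsBudgetedStep R B w T₁ T₂

variable {B : ℕ → AnnTree → AnnTree → Prop}

theorem IsBudgetedSimulation.deannotate_eq (hB : IsBudgetedSimulation R B) (h : B w T₁ T₂) :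
    T₁.deannotate = T₂.deannotate := by
  funext p
  induction p generalizing w T₁ T₂ with
  | nil => exact (hB h).1
  | cons i p ih =>
    obtain ⟨-, c, -, -, hc⟩ := hB h
    exact ih (hc i)

theorem IsBudgetedSimulation.encard_failures_length_lt_le (hB : IsBudgetedSimulation R B)
    (h : B w T₁ T₂) (d : ℕ) : {p ∈ failures R T₁ T₂ | p.length < d}.encard ≤ w := by
  induction d generalizing w T₁ T₂ with
  | zero => simp
  | succ d ih =>
    obtain ⟨-, c, hw, hnil, hc⟩ := hB h
    refine encard_le_of_encard_cons_le (fun i => ?_) hw fun hp => hnil hp.1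
    refine (Set.encard_le_encard ?_).trans (ih (hc i))
    exact fun p hp => ⟨hp.1, Nat.lt_of_succ_lt_succ hp.2⟩

theorem IsBudgetedSimulation.relEventually (hB : IsBudgetedSimulation R B) (h : B w T₁ T₂) :
    RelEventually R T₁ T₂ := by
  have finite : (failures R T₁ T₂).Finite :=
    finite_of_forall_encard_length_lt_le (hB.encard_failures_length_lt_le h)
  obtain ⟨l, hl⟩ := (finite.image List.length).bddAbove
  refine ⟨hB.deannotate_eq h, l + 1, fun p hp hlp => by_contra fun hn => ?_⟩
  exact absurd (hl ⟨p, ⟨hp, hn⟩, rfl⟩) (not_le.2 hlp)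

end AnnTree

/-! ### Comparison of clocked Böhm trees -/

namespace LTerm

/-- The `i`-th subtree of the root of the annotated term generated by a part `H` of a head normal
form. -/
noncomputable def childTree (H : LTerm) (i : Fin 3) : AnnTree :=
  fun p => (frameChild H i).bind fun s => unfold s p

theorem unfold_eq_of_resolve_eq {s t : BTState} (h : resolve s = resolve t) :
    unfold s = unfold t := by
  funext p
  cases p <;> simp only [unfold, h]

theorem unfold_nil {s : BTState} {a : Option ℕ} {H : LTerm} (h : resolve s = some (a, H)) :
    unfold s [] = some ⟨rootSym H, a⟩ := by
  simp only [unfold, h]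

theorem subtree_unfold {s : BTState} {a : Option ℕ} {H : LTerm} (h : resolve s = some (a, H))
    (i : Fin 3) : (unfold s).subtree i = childTree H i := by
  funext p
  simp only [AnnTree.subtree, childTree, unfold, h]

theorem HeadNormalizes.resolve_eval {k : ℕ} {M H : LTerm} (h : HeadNormalizes ⊤ k M H) :
    resolve (.eval M) = some (some k, H) := by
  rw [resolve, if_pos (hasHnf_iff_exists_headNormalizes.2 ⟨k, H, h⟩), h.headReduct_eq]

/-- The trees generated by states whose terms are related by `Tracks`, a budgeted simulation. -/
inductive TreeTracks : ℕ → AnnTree → AnnTree → Prop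
  | refl (w : ℕ) (T : AnnTree) : TreeTracks w T T
  | eval {w : ℕ} {M N : LTerm} (hM : Simple M) (h : Tracks w M N) :
      TreeTracks w (unfold (.eval M)) (unfold (.eval N))
  | frame {w : ℕ} {H K : LTerm} (hH : HeadNormal Simple H) (hK : HeadNormal ⊤ K)
      (h : Tracks w H K) : TreeTracks w (unfold (.frame H)) (unfold (.frame K))

theorem Tracks.treeTracks_childTree {w : ℕ} {H K : LTerm} (h : Tracks w H K)
    (hH : HeadNormal Simple H) (hK : HeadNormal ⊤ K) :
    rootSym H = rootSym K ∧ ∃ c : Fin 3 → ℕ, ∑ i, c i ≤ w ∧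
      ∀ i, TreeTracks (c i) (childTree H i) (childTree K i) := by
  cases hH with
  | neutral hH =>
    cases hH with
    | var y =>
      obtain rfl := h.of_var hK
      exact ⟨rfl, 0, by simp, fun i => .refl _ _⟩
    | app hA hB =>
      obtain ⟨A', B', a, b, rfl, hA', hAA', hBB', hw⟩ := h.of_neutral_app (hA.app hB) hK
      refine ⟨rfl, ![0, a, b], by simpa [Fin.sum_univ_three] using hw, fun i => ?_⟩
      fin_cases i
      exacts [.refl _ _, .frame (.neutral hA) hA' hAA', .eval hB hBB']
  | lam hA =>
    obtain ⟨A', rfl, hA', hAA'⟩ := h.of_lam hK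
    refine ⟨rfl, ![w, 0, 0], by simp [Fin.sum_univ_three], fun i => ?_⟩
    fin_cases i
    exacts [.frame hA hA' hAA', .refl _ _, .refl _ _]

theorem isBudgetedStep_of_resolve {v w : ℕ} {s t : BTState} {a b : Option ℕ} {H K : LTerm}
    (hs : resolve s = some (a, H)) (ht : resolve t = some (b, K)) (h : Tracks v H K)
    (hH : HeadNormal Simple H) (hK : HeadNormal ⊤ K) (hvw : v ≤ w)
    (hroot : [] ∈ AnnTree.failures (· ≤ ·) (unfold s) (unfold t) → v < w) :
    AnnTree.IsBudgetedStep (· ≤ ·) TreeTracks w (unfold s) (unfold t) := by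
  obtain ⟨hsym, c, hc, hchild⟩ := h.treeTracks_childTree hH hK
  refine ⟨?_, c, hc.trans hvw, fun hp => hc.trans_lt (hroot hp), fun i => ?_⟩
  · simp only [AnnTree.deannotate, unfold_nil hs, unfold_nil ht, Option.map_some, hsym]
  · rw [subtree_unfold hs, subtree_unfold ht]
    exact hchild i

theorem isBudgetedSimulation_treeTracks : AnnTree.IsBudgetedSimulation (· ≤ ·) TreeTracks := by
  have refl_case (w : ℕ) (T : AnnTree) : AnnTree.IsBudgetedStep (· ≤ ·) TreeTracks w T T :=
    ⟨rfl, 0, by simp, by simp [AnnTree.failures_self], fun i => .refl _ _⟩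
  intro w T₁ T₂ h
  cases h with
  | refl => exact refl_case w T₁
  | frame hH hK h =>
    refine isBudgetedStep_of_resolve rfl rfl h hH hK le_rfl fun hp => absurd ?_ hp.2
    exact ⟨_, _, unfold_nil rfl, unfold_nil rfl, .inl ⟨rfl, rfl⟩⟩
  | @eval M N hM h =>
    by_cases hnf : HasHnf M
    · obtain ⟨j, H, hMH, hH⟩ := hM.exists_headNormalizes hnf
      obtain ⟨k, K, hNK⟩ := hasHnf_iff_exists_headNormalizes.1 (h.hasHnf_iff.1 hnf)
      obtain ⟨v, hvw, hv, hjk⟩ := h.headNormalizes hMH hNK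
      have hs := (hMH.mono le_top).resolve_eval
      have ht := hNK.resolve_eval
      refine isBudgetedStep_of_resolve hs ht hv hH hNK.headNormal hvw fun hp => ?_
      by_contra hlt
      exact hp.2 ⟨_, _, unfold_nil hs, unfold_nil ht, .inr ⟨j, k, rfl, rfl, by omega⟩⟩
    · have : resolve (.eval M) = resolve (.eval N) := by
        rw [resolve, resolve, if_neg hnf, if_neg (mt h.hasHnf_iff.2 hnf)]
      rw [unfold_eq_of_resolve_eq this]
      exact refl_case w _

end LTerm

theorem mainTheorem2 (M N : LTerm) (hM : LTerm.Simple M)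
    (hMN : ¬ LTerm.ImprovesEventually M N) : ¬ LTerm.Conv M N := by
  intro hconv
  obtain ⟨P, hMP, hNP⟩ := hconv.exists_red
  obtain ⟨w, hw⟩ := hMP.exists_stdRed
  exact hMN (LTerm.isBudgetedSimulation_treeTracks.relEventually (.eval hM ⟨P, hw, hNP⟩))
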